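/- **Theorem 1.1 (Total positivity of Lah matrices and Lah polynomials).** A *partially ordered commutative ring* is a commutative ring $R$ together with a subset $\mathcal P\subseteq R$ (its *nonnegative elements*) such that $0,1\in\mathcal P$, $\mathcal P$ is closed under addition and multiplication, and $\mathcal P\cap(-\mathcal P)=\{0\}$. In the polynomial ring $R[y]$ with the *coefficientwise order*, the nonnegative elements are the polynomials all of whose coefficients are nonnegative. For $1\le r\le\infty$, a matrix $(a_{ij})_{i,j\ge 0}$ over such a ring is *totally positive of order $r$* ($\mathrm{TP}_r$) if all its (finite) minors of size $\le r$ are nonnegative. A sequence $(a_n)_{n\ge 0}$ is *Toeplitz-$\mathrm{TP}_r$* if the matrix $(a_{i-j})_{i,j\ge 0}$ (with $a_n=0$ for $n<0$) is $\mathrm{TP}_r$, and *Hankel-$\mathrm{TP}_r$* if the matrix $(a_{i+j})_{i,j\ge 0}$ is $\mathrm{TP}_r$. For a sequence $\phi=(\phi_i)_{i\ge 0}$ in $R$, let $L_{n,k}(\phi)$ be the sum, over all unordered forests of increasing ordered trees on the vertex set $\{1,\dots,n\}$ having exactly $k$ components, of the product over all vertices of $\phi_i$, where $i$ is the number of children of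 the vertex. (An *increasing ordered tree* is a rooted tree in which the children of each vertex are linearly ordered and each child has a larger label than its parent; the empty forest gives $L_{0,0}(\phi)=1$.) Let $L_n(\phi,y)=\sum_{k=0}^n L_{n,k}(\phi)\,y^k\in R[y]$. Fix $1\le r\le\infty$, let $R$ be a partially ordered commutative ring, and let $\phi=(\phi_i)_{i\ge 0}$ be a sequence in $R$ that is Toeplitz-$\mathrm{TP}_r$. Then: (a) The lower-triangular matrix $(L_{n,k}(\phi))_{n,k\ge 0}$ is $\mathrm{TP}_r$ in $R$. (b) The sequence $(L_n(\phi,y))_{n\ge 0}$ is Hankel-$\mathrm{TP}_r$ in $R[y]$ equipped with the coefficientwise order. (c) The sequence $(L_{n+1,1}(\phi))_{n\ge 0}$ is Hankel-$\mathrm{TP}_r$ in $R$. -/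

import Mathlib

open Polynomial

namespace LahTP

/-! ### Partially ordered commutative rings

A partially ordered commutative ring is a pair `(R, C)` with `C : RingCone R` the set of nonnegative
elements: `C` contains `0` and `1`, is closed under addition and multiplication, and
`C ∩ (-C) = {0}`. -/

/-- The coefficientwise order on `R[y]`: a polynomial is nonnegative when all its coefficients
are nonnegative. -/
def coeffCone {R : Type*} [CommRing R] (C : RingCone R) : RingCone R[X] where
  carrier := {p | ∀ i, p.coeff i ∈ C}
  mul_mem' := by
    intro p q hp hq i
    rw [Polynomial.coeff_mul]
    exact sum_mem fun x _ => mul_mem (hp x.1) (hq x.2)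
  one_mem' := by
    intro i
    rw [Polynomial.coeff_one]
    split_ifs
    · exact one_mem C
    · exact zero_mem C
  add_mem' := by
    intro p q hp hq i
    rw [Polynomial.coeff_add]
    exact add_mem (hp i) (hq i)
  zero_mem' := by
    intro i
    rw [Polynomial.coeff_zero]
    exact zero_mem C
  eq_zero_of_mem_of_neg_mem' := by
    intro p hp hn
    ext i
    have h := hn i
    rw [Polynomial.coeff_neg] at h
    rw [Polynomial.coeff_zero]
    exact eq_zero_of_mem_of_neg_mem (hp i) h

/-! ### Total positivity -/

/-- An infinite matrix is totally positive of order `r` (`1 ≤ r ≤ ∞`) when all its minors of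
size `≤ r` are nonnegative; for `r = ∞` this is total positivity. -/
def IsTP {R : Type*} [CommRing R] (C : RingCone R) (r : ℕ∞) (A : Matrix ℕ ℕ R) : Prop :=
  ∀ m : ℕ, (m : ℕ∞) ≤ r → ∀ rows cols : Fin m → ℕ, StrictMono rows → StrictMono cols →
    (A.submatrix rows cols).det ∈ C

/-- The infinite Toeplitz matrix `(a_{i-j})_{i,j ≥ 0}`, with `a_n = 0` for `n < 0`. -/
def toeplitz {R : Type*} [CommRing R] (a : ℕ → R) : Matrix ℕ ℕ R :=
  Matrix.of fun i j => if j ≤ i then a (i - j) else 0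

/-- The infinite Hankel matrix `(a_{i+j})_{i,j ≥ 0}`. -/
def hankel {R : Type*} [CommRing R] (a : ℕ → R) : Matrix ℕ ℕ R :=
  Matrix.of fun i j => a (i + j)

/-- Toeplitz-total positivity of order `r`. -/
def IsToeplitzTP {R : Type*} [CommRing R] (C : RingCone R) (r : ℕ∞) (a : ℕ → R) : Prop :=
  IsTP C r (toeplitz a)

/-- Hankel-total positivity of order `r`. -/
def IsHankelTP {R : Type*} [CommRing R] (C : RingCone R) (r : ℕ∞) (a : ℕ → R) : Prop :=
  IsTP C r (hankel a)

/-! ### Unordered forests of increasing ordered trees -/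

/-- An unordered forest of increasing ordered trees on the vertex set `{0, …, n-1}`.
Since the vertices are labelled, such a forest amounts to specifying for each vertex the
(linearly ordered) list of its children, where every child has a larger label than its
parent and every vertex has at most one parent. Acyclicity follows from the increasing
condition, and the trees themselves are not ordered. -/
@[ext]
structure IncForest (n : ℕ) where
  /-- the ordered list of children of a vertex -/
  children : Fin n → List (Fin n)
  nodup : ∀ u, (children u).Nodup
  increasing : ∀ u, ∀ v ∈ children u, u < v
  parent_unique : ∀ u u' v, v ∈ children u → v ∈ children u' → u = u'

/-- There are finitely many forests on a finite vertex set. -/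
instance IncForest.instFintype (n : ℕ) : Fintype (IncForest n) :=
  Fintype.ofEquiv
    {c : Fin n → {l : List (Fin n) // l.Nodup} //
      (∀ u, ∀ v ∈ (c u).1, u < v) ∧ ∀ u u' v, v ∈ (c u).1 → v ∈ (c u').1 → u = u'}
    { toFun := fun c => ⟨fun u => (c.1 u).1, fun u => (c.1 u).2, c.2.1, c.2.2⟩
      invFun := fun F => ⟨fun u => ⟨F.children u, F.nodup u⟩, F.increasing, F.parent_unique⟩
      left_inv := fun _ => rfl
      right_inv := fun _ => rfl }

/-- The roots of a forest: the vertices that are nobody's child. -/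
def IncForest.roots {n : ℕ} (F : IncForest n) : Finset (Fin n) :=
  Finset.univ.filter fun v => ∀ u, v ∉ F.children u

/-- The number of components (trees) of a forest; each tree has exactly one root. -/
def IncForest.numTrees {n : ℕ} (F : IncForest n) : ℕ :=
  F.roots.card

/-- The weight of a forest: each vertex with `i` children gets a weight `φ i`. -/
def IncForest.weight {R : Type*} [CommRing R] {n : ℕ} (φ : ℕ → R) (F : IncForest n) : R :=
  ∏ v : Fin n, φ (F.children v).length

/-! ### Generic Lah polynomials -/

/-- The generic Lah polynomial `L_{n,k}(φ)`: the sum of the weights of the unordered forests of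
increasing ordered trees on `n` vertices having `k` components. -/
def genericLah {R : Type*} [CommRing R] (φ : ℕ → R) (n k : ℕ) : R :=
  ∑ F : IncForest n with F.numTrees = k, F.weight φ

/-- The generic Lah triangle `(L_{n,k}(φ))_{n,k ≥ 0}`. -/
def lahTriangle {R : Type*} [CommRing R] (φ : ℕ → R) : Matrix ℕ ℕ R :=
  Matrix.of fun n k => genericLah φ n k

/-- The row-generating polynomial `L_n(φ, y) = ∑_{k=0}^n L_{n,k}(φ) y^k`. -/
noncomputable def lahPoly {R : Type*} [CommRing R] (φ : ℕ → R) (n : ℕ) : R[X] :=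
  ∑ k ∈ Finset.range (n + 1), C (genericLah φ n k) * X ^ k

end LahTP

/-! Write F for `factorialToeplitz φ`, Δ for the matrix with ones on the superdiagonal, B_y for
`binomialTriangle y`, and L for the Lah triangle. Deleting the smallest vertex of a forest gives
`genericLah_succ_succ`, which says ΔL = LFΔ. Up to conjugation by diag(n!), both F and B_y are
lower-triangular Toeplitz matrices, so they commute; Pascal's rule reads ΔB_y = B_y(yI + Δ). Hence
Δ(LB_y) = (LB_y)P with P = F(yI + Δ): the rows of LB_y are the zeroth rows of the powers of P.

Here F inherits total positivity from the Toeplitz matrix (`MinorsNonneg.descFactorial_mul`), and yI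
+ Δ is totally positive for y ≥ 0, so P is too, by Cauchy–Binet. Total positivity of P passes to the
matrix of zeroth rows of its powers (`MinorsNonneg.zeroth_rows_pow`) and to the Hankel matrix of the
moments (Pⁿ)₀₀ (`MinorsNonneg.hankel_pow`).

Taking y = 0 gives (a). Column zero of LB_y holds the row polynomials, so y = X over R[X] gives (b).
For (c), L without its zeroth row and column starts from φ₀e₀ and has production matrix ΔF, a
submatrix of F. Finite truncations stand in for the infinite matrices. -/

namespace LahTP

/-! ### Total positivity for matrices indexed by arbitrary ordered types -/

section Minors

variable {R : Type*} [CommRing R] {C : RingCone R} {r : ℕ∞}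

/-- All minors of size at most `r` of the matrix `A` are nonnegative. -/
def MinorsNonneg {α β : Type*} [Preorder α] [Preorder β] (C : RingCone R) (r : ℕ∞)
    (A : Matrix α β R) : Prop :=
  ∀ m : ℕ, (m : ℕ∞) ≤ r → ∀ (rows : Fin m → α) (cols : Fin m → β), StrictMono rows →
    StrictMono cols → (A.submatrix rows cols).det ∈ C

theorem MinorsNonneg.submatrix {α β γ δ : Type*} [Preorder α] [Preorder β] [Preorder γ]
    [Preorder δ] {A : Matrix α β R} (hA : MinorsNonneg C r A) {f : γ → α} {g : δ → β}
    (hf : StrictMono f) (hg : StrictMono g) : MinorsNonneg C r (A.submatrix f g) := by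
  intro m hm rows cols hrows hcols
  rw [Matrix.submatrix_submatrix]
  exact hA m hm _ _ (hf.comp hrows) (hg.comp hcols)

theorem MinorsNonneg.transpose {α β : Type*} [Preorder α] [Preorder β] {A : Matrix α β R}
    (hA : MinorsNonneg C r A) : MinorsNonneg C r A.transpose := by
  intro m hm rows cols hrows hcols
  rw [← Matrix.transpose_submatrix, Matrix.det_transpose]
  exact hA m hm _ _ hcols hrows

theorem MinorsNonneg.map {α β S : Type*} [Preorder α] [Preorder β] [CommRing S]
    {D : RingCone S} {A : Matrix α β R} (hA : MinorsNonneg C r A) (f : R →+* S)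
    (hf : ∀ x ∈ C, f x ∈ D) : MinorsNonneg D r (A.map f) := by
  intro m hm rows cols hrows hcols
  rw [Matrix.submatrix_map, ← RingHom.mapMatrix_apply, ← RingHom.map_det]
  exact hf _ (hA m hm _ _ hrows hcols)

theorem MinorsNonneg.smul {α β : Type*} [Preorder α] [Preorder β] {A : Matrix α β R}
    (hA : MinorsNonneg C r A) {c : R} (hc : c ∈ C) : MinorsNonneg C r (c • A) := by
  intro m hm rows cols hrows hcols
  rw [Matrix.submatrix_smul, Pi.smul_apply, Pi.smul_apply, Matrix.det_smul]
  exact mul_mem (pow_mem hc _) (hA m hm _ _ hrows hcols)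

theorem minorsNonneg_of_truncations {A : Matrix ℕ ℕ R}
    (hA : ∀ N : ℕ, MinorsNonneg C r
      (A.submatrix (Fin.val : Fin (N + 1) → ℕ) (Fin.val : Fin (N + 1) → ℕ))) :
    MinorsNonneg C r A := by
  intro m hm rows cols hrows hcols
  -- A crude common bound for all the indices of the minor.
  let N := ∑ i, rows i + ∑ i, cols i
  have hr (i : Fin m) : rows i < N + 1 := by
    have := Finset.single_le_sum (f := rows) (fun _ _ => Nat.zero_le _) (Finset.mem_univ i)
    omega
  have hc (i : Fin m) : cols i < N + 1 := by
    have := Finset.single_le_sum (f := cols) (fun _ _ => Nat.zero_le _) (Finset.mem_univ i)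
    omega
  exact hA N m hm (fun i => ⟨rows i, hr i⟩) (fun i => ⟨cols i, hc i⟩)
    (fun _ _ h => hrows h) (fun _ _ h => hcols h)

/-- The Cauchy–Binet formula. -/
theorem det_mul_eq_sum_orderEmbedding {m : ℕ} {β : Type*} [Fintype β] [LinearOrder β]
    (A : Matrix (Fin m) β R) (B : Matrix β (Fin m) R) :
    (A * B).det = ∑ g : Fin m ↪o β, (A.submatrix id g).det * (B.submatrix g id).det := by
  -- Multilinearity in the columns: column `i` of `A * B` is a combination of columns of `A`, and `f
  -- i` records the one chosen.
  have expand : (A * B).det = ∑ f : Fin m → β, (A.submatrix id f).det * ∏ i, B (f i) i := by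
    simp only [Matrix.det_apply', Matrix.mul_apply, Finset.prod_univ_sum, Finset.mul_sum,
      Fintype.piFinset_univ]
    rw [Finset.sum_comm]
    refine Finset.sum_congr rfl fun f _ => ?_
    rw [Finset.sum_mul]
    refine Finset.sum_congr rfl fun σ _ => ?_
    simp [Finset.prod_mul_distrib, mul_assoc]
  -- A non-injective `f` repeats a column of `A`.
  have inj : ∑ f : Fin m → β, (A.submatrix id f).det * ∏ i, B (f i) i =
      ∑ f : Fin m → β with Function.Injective f,
        (A.submatrix id f).det * ∏ i, B (f i) i := by
    refine (Finset.sum_subset (Finset.filter_subset _ _) fun f _ hf => ?_).symm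
    have hf' : ¬ Function.Injective f := by simpa using hf
    obtain ⟨i, j, hij, hne⟩ : ∃ i j, f i = f j ∧ i ≠ j := by
      simpa [Function.Injective] using hf'
    rw [Matrix.det_zero_of_column_eq hne (by simp [hij]), zero_mul]
  -- An injective `f` is uniquely an increasing map after a permutation; sorting supplies both.
  have factor : ∑ f : Fin m → β with Function.Injective f,
        (A.submatrix id f).det * ∏ i, B (f i) i =
      ∑ x : (Fin m ↪o β) × Equiv.Perm (Fin m),
        (A.submatrix id (x.1 ∘ x.2)).det * ∏ i, B (x.1 (x.2 i)) i := by
    symm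
    refine Finset.sum_bij (fun x _ => x.1 ∘ x.2) ?_ ?_ ?_ ?_
    · rintro ⟨g, σ⟩ -
      simpa using g.injective.comp σ.injective
    · rintro ⟨g, σ⟩ - ⟨g', σ'⟩ - h
      have hg : g = g' := by
        have hrange : Set.range g = Set.range g' := by
          have h' := congrArg Set.range h
          simpa [Set.range_comp] using h'
        exact OrderEmbedding.range_inj.mp hrange
      subst hg
      congr 1
      ext i : 1
      exact g.injective (congrFun h i)
    · intro f hf
      have hf' : Function.Injective f := by simpa using hf
      refine ⟨(OrderEmbedding.ofStrictMono (f ∘ Tuple.sort f)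
        ((Tuple.monotone_sort f).strictMono_of_injective
          (hf'.comp (Tuple.sort f).injective)), (Tuple.sort f)⁻¹), Finset.mem_univ _, ?_⟩
      ext i
      simp
    · intros
      rfl
  rw [expand, inj, factor, Fintype.sum_prod_type]
  refine Finset.sum_congr rfl fun g _ => ?_
  rw [Matrix.det_apply' (B.submatrix g id), Finset.mul_sum]
  refine Finset.sum_congr rfl fun σ _ => ?_
  have h : A.submatrix id (g ∘ σ) = (A.submatrix id g).submatrix id σ := rfl
  rw [h, Matrix.det_permute']
  simp only [Matrix.submatrix_apply, id]
  ring

theorem MinorsNonneg.mul {α β γ : Type*} [Preorder α] [Fintype β] [LinearOrder β] [Preorder γ]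
    {A : Matrix α β R} {B : Matrix β γ R} (hA : MinorsNonneg C r A) (hB : MinorsNonneg C r B) :
    MinorsNonneg C r (A * B) := by
  intro m hm rows cols hrows hcols
  have h : (A * B).submatrix rows cols = A.submatrix rows id * B.submatrix id cols := rfl
  rw [h, det_mul_eq_sum_orderEmbedding]
  exact sum_mem fun g _ => mul_mem (hA m hm _ _ hrows g.strictMono)
    (hB m hm _ _ g.strictMono hcols)

/-! ### Bidiagonal matrices, powers and Hankel moments. -/

theorem det_eq_mul_of_row_zero {n : ℕ} (M : Matrix (Fin (n + 1)) (Fin (n + 1)) R)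
    (h : ∀ j : Fin n, M 0 j.succ = 0) :
    M.det = M 0 0 * (M.submatrix Fin.succ Fin.succ).det := by
  rw [Matrix.det_succ_row_zero, Fin.sum_univ_succ]
  simp [h]

theorem det_eq_mul_of_column_zero {n : ℕ} (M : Matrix (Fin (n + 1)) (Fin (n + 1)) R)
    (h : ∀ j : Fin n, M j.succ 0 = 0) :
    M.det = M 0 0 * (M.submatrix Fin.succ Fin.succ).det := by
  rw [← Matrix.det_transpose, det_eq_mul_of_row_zero _ h, ← Matrix.det_transpose
    (M.submatrix _ _)]
  rfl

/-- The upper bidiagonal matrix with `y` on the diagonal and `1` on the superdiagonal. -/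
def bidiagonal (y : R) : Matrix ℕ ℕ R :=
  Matrix.of fun i j => (if i = j then y else 0) + if i + 1 = j then 1 else 0

theorem bidiagonal_minorsNonneg {y : R} (hy : y ∈ C) : MinorsNonneg C r (bidiagonal y) := by
  intro m _ rows cols hrows hcols
  induction m with
  | zero => simp
  | succ m ih =>
    have entry (i j : ℕ) : bidiagonal y i j ∈ C := by
      simp only [bidiagonal, Matrix.of_apply]
      exact add_mem (by split_ifs; exacts [hy, zero_mem C])
        (by split_ifs; exacts [one_mem C, zero_mem C])
    have minor := ih ((Nat.cast_le.mpr m.le_succ).trans ‹_›) (rows ∘ Fin.succ) (cols ∘ Fin.succ)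
      (hrows.comp (Fin.strictMono_succ)) (hcols.comp (Fin.strictMono_succ))
    have hr (i : Fin m) := hrows (Fin.succ_pos i)
    have hc (i : Fin m) := hcols (Fin.succ_pos i)
    have key : ((bidiagonal y).submatrix rows cols).det = bidiagonal y (rows 0) (cols 0) *
        ((bidiagonal y).submatrix (rows ∘ Fin.succ) (cols ∘ Fin.succ)).det := by
      -- The support is so narrow that either the first row or the first column of the minor
      -- vanishes off the corner.
      rcases Nat.lt_or_ge (rows 0) (cols 0) with h | h
      · refine det_eq_mul_of_row_zero _ fun j => ?_
        have := hc j
        simp only [bidiagonal, Matrix.submatrix_apply, Matrix.of_apply]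
        rw [if_neg (by omega), if_neg (by omega), add_zero]
      · refine det_eq_mul_of_column_zero _ fun j => ?_
        have := hr j
        simp only [bidiagonal, Matrix.submatrix_apply, Matrix.of_apply]
        rw [if_neg (by omega), if_neg (by omega), add_zero]
    rw [key]
    exact mul_mem (entry _ _) minor

/-- The matrix of zeroth rows of the powers of a totally positive matrix is totally positive. -/
theorem MinorsNonneg.zeroth_rows_pow {N : ℕ} {P : Matrix (Fin (N + 1)) (Fin (N + 1)) R}
    (hP : MinorsNonneg C r P) :
    MinorsNonneg C r (Matrix.of fun (i : ℕ) (k : Fin (N + 1)) => (P ^ i) 0 k) := by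
  set X : Matrix ℕ (Fin (N + 1)) R := Matrix.of fun i k => (P ^ i) 0 k with hX
  -- Induction on a strict upper bound `n` for the exponents that occur as rows.
  suffices H : ∀ n m : ℕ, (m : ℕ∞) ≤ r → ∀ (rows : Fin m → ℕ) (cols : Fin m → Fin (N + 1)),
      StrictMono rows → StrictMono cols → (∀ i, rows i < n) →
      (X.submatrix rows cols).det ∈ C by
    intro m hm rows cols hrows hcols
    refine H (∑ i, rows i + 1) m hm rows cols hrows hcols fun i => ?_
    exact Nat.lt_succ_of_le
      (Finset.single_le_sum (f := rows) (fun _ _ => Nat.zero_le _) (Finset.mem_univ i))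
  intro n
  induction n with
  | zero =>
    intro m _ rows cols _ _ hlt
    have : IsEmpty (Fin m) := ⟨fun i => absurd (hlt i) (Nat.not_lt_zero _)⟩
    simp
  | succ n ih =>
    -- If no row has exponent 0, one factor `P` splits off on the right; Cauchy–Binet then lowers
    -- every exponent by one.
    have step : ∀ m : ℕ, (m : ℕ∞) ≤ r → ∀ (rows : Fin m → ℕ) (cols : Fin m → Fin (N + 1)),
        StrictMono rows → StrictMono cols → (∀ i, 0 < rows i) → (∀ i, rows i < n + 1) →
        (X.submatrix rows cols).det ∈ C := by
      intro m hm rows cols hrows hcols hpos hlt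
      have hmul : X.submatrix rows cols =
          X.submatrix (fun i => rows i - 1) id * P.submatrix id cols := by
        ext i j
        have h1 : rows i = rows i - 1 + 1 := by have := hpos i; omega
        rw [Matrix.submatrix_apply, h1]
        simp [hX, pow_succ, Matrix.mul_apply]
      rw [hmul, det_mul_eq_sum_orderEmbedding]
      refine sum_mem fun g _ => mul_mem ?_ (hP m hm _ _ g.strictMono hcols)
      refine ih m hm _ _ (fun a b hab => ?_) g.strictMono fun i => ?_
      · have := hrows hab
        have := hpos a
        show rows a - 1 < rows b - 1
        omega
      · have := hlt i
        have := hpos i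
        show rows i - 1 < n
        omega
    intro m hm rows cols hrows hcols hlt
    cases m with
    | zero => simp
    | succ m =>
      -- A row of exponent 0 is a row of the identity, zero at all columns after the first;
      -- expanding along it leaves only positive exponents.
      rcases Nat.eq_zero_or_pos (rows 0) with h0 | h0
      · have hrow (j : Fin m) : (X.submatrix rows cols) 0 j.succ = 0 := by
          have hne : (0 : Fin (N + 1)) ≠ cols j.succ :=
            ((Fin.zero_le _).trans_lt (hcols (Fin.succ_pos j))).ne
          simp [hX, h0, hne]
        rw [det_eq_mul_of_row_zero _ hrow]
        refine mul_mem ?_ ?_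
        · simp only [hX, Matrix.submatrix_apply, Matrix.of_apply, h0, pow_zero, Matrix.one_apply]
          split_ifs
          exacts [one_mem C, zero_mem C]
        · refine step m ((Nat.cast_le.mpr m.le_succ).trans hm) (rows ∘ Fin.succ) (cols ∘ Fin.succ)
            (hrows.comp Fin.strictMono_succ) (hcols.comp Fin.strictMono_succ) (fun i => ?_)
            fun i => hlt _
          exact (Nat.zero_le _).trans_lt (hrows (Fin.succ_pos i))
      · exact step _ hm rows cols hrows hcols
          (fun i => h0.trans_le (hrows.monotone (Fin.zero_le i))) hlt

/-- The moment sequence `(Pⁿ)₀₀` of a totally positive matrix is Hankel-totally positive. -/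
theorem MinorsNonneg.hankel_pow {N : ℕ} {P : Matrix (Fin (N + 1)) (Fin (N + 1)) R}
    (hP : MinorsNonneg C r P) : MinorsNonneg C r (hankel fun n => (P ^ n) 0 0) := by
  -- (P^(i+j))₀₀ = ∑ₖ (Pⁱ)₀ₖ (Pʲ)ₖ₀, and the second factor comes from the powers of the transpose.
  have h := hP.zeroth_rows_pow.mul hP.transpose.zeroth_rows_pow.transpose
  convert h using 1
  ext i j
  simp [hankel, pow_add, Matrix.mul_apply, ← Matrix.transpose_pow]

/-- Pigeonhole: otherwise `σ` would inject the indices `≥ l` into those `> l`. Consequently every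
term of such a minor of a lower-triangular matrix vanishes. -/
theorem exists_apply_lt_of_apply_lt {m : ℕ} {rows cols : Fin m → ℕ} (hrows : StrictMono rows)
    (hcols : StrictMono cols) {l : Fin m} (hl : rows l < cols l) (σ : Equiv.Perm (Fin m)) :
    ∃ p, rows (σ p) < cols p := by
  by_contra! h
  have hsub : (Finset.Ici l).map σ.toEmbedding ⊆ Finset.Ioi l := by
    intro x hx
    obtain ⟨p, hp, rfl⟩ := Finset.mem_map.mp hx
    rw [Finset.mem_Ioi]
    refine hrows.lt_iff_lt.mp ?_
    exact hl.trans_le ((hcols.monotone (Finset.mem_Ici.mp hp)).trans (h p))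
  have hcard := Finset.card_le_card hsub
  rw [Finset.card_map, Fin.card_Ici, Fin.card_Ioi] at hcard
  have := l.isLt
  omega

/-- Total positivity of a lower-triangular matrix is preserved when the entry `(n, k)` is
multiplied by `n! / k!`. -/
theorem MinorsNonneg.descFactorial_mul {A : Matrix ℕ ℕ R} (hA : MinorsNonneg C r A)
    (hlow : ∀ i j, i < j → A i j = 0) :
    MinorsNonneg C r (Matrix.of fun i j => (i.descFactorial (i - j) : R) * A i j) := by
  intro m hm rows cols hrows hcols
  -- This is conjugation by diag(n!) without division: every nonvanishing term of the determinant
  -- acquires the same factor ∏ rows! / ∏ cols!.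
  by_cases hle : ∀ l, cols l ≤ rows l
  · have key : ((Matrix.of fun i j => (i.descFactorial (i - j) : R) * A i j).submatrix
        rows cols).det = ((∏ l, (rows l).descFactorial (rows l - cols l) : ℕ) : R) *
          (A.submatrix rows cols).det := by
      rw [Matrix.det_apply', Matrix.det_apply', Finset.mul_sum]
      refine Finset.sum_congr rfl fun σ _ => ?_
      simp only [Matrix.submatrix_apply, Matrix.of_apply, Finset.prod_mul_distrib]
      by_cases hσ : ∀ p, cols p ≤ rows (σ p)
      · have hnat : ∏ p, (rows (σ p)).descFactorial (rows (σ p) - cols p) =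
            ∏ l, (rows l).descFactorial (rows l - cols l) := by
          have hpos : 0 < ∏ p, (cols p).factorial :=
            Finset.prod_pos fun p _ => Nat.factorial_pos _
          refine Nat.eq_of_mul_eq_mul_left hpos ?_
          have hfac {a b : ℕ} (hab : b ≤ a) :
              b.factorial * a.descFactorial (a - b) = a.factorial := by
            have := Nat.factorial_mul_descFactorial (Nat.sub_le a b)
            rwa [Nat.sub_sub_self hab] at this
          rw [← Finset.prod_mul_distrib, ← Finset.prod_mul_distrib,
            Finset.prod_congr rfl fun p _ => hfac (hσ p),
            Finset.prod_congr rfl fun p _ => hfac (hle p)]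
          exact Equiv.prod_comp σ fun p => (rows p).factorial
        rw [← Nat.cast_prod, hnat]
        ring
      · push Not at hσ
        obtain ⟨p, hp⟩ := hσ
        rw [Finset.prod_eq_zero (f := fun p => A (rows (σ p)) (cols p)) (Finset.mem_univ p)
          (hlow _ _ hp)]
        ring
    rw [key]
    exact mul_mem (natCast_mem C _) (hA m hm _ _ hrows hcols)
  · push Not at hle
    obtain ⟨l, hl⟩ := hle
    rw [Matrix.det_apply']
    refine sum_mem fun σ _ => ?_
    obtain ⟨p, hp⟩ := exists_apply_lt_of_apply_lt hrows hcols hl σ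
    rw [Finset.prod_eq_zero (Finset.mem_univ p) (by simp [hlow _ _ hp]), mul_zero]
    exact zero_mem C

end Minors

/-! ### Removing the smallest vertex of a forest -/

section Forests

variable {n : ℕ}

/-- Add a new smallest vertex to a forest, whose children are the given list of roots. -/
def IncForest.cons (F : IncForest n) (l : List (Fin n)) (hl : l.Nodup)
    (hroots : ∀ v ∈ l, v ∈ F.roots) : IncForest (n + 1) where
  children := Fin.cons (l.map Fin.succ) fun u => (F.children u).map Fin.succ
  nodup u := by
    refine Fin.cases ?_ (fun u => ?_) u
    · exact hl.map (Fin.succ_injective n)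
    · exact (F.nodup u).map (Fin.succ_injective n)
  increasing u := by
    refine Fin.cases ?_ (fun u => ?_) u
    · intro v hv
      obtain ⟨w, -, rfl⟩ := List.mem_map.mp hv
      exact Fin.succ_pos w
    · intro v hv
      obtain ⟨w, hw, rfl⟩ := List.mem_map.mp hv
      exact Fin.succ_lt_succ_iff.mpr (F.increasing u w hw)
  parent_unique u u' v := by
    have hmem {w : Fin n} {t : List (Fin n)} : w.succ ∈ t.map Fin.succ ↔ w ∈ t := by
      simp
    have hroot (w u : Fin n) (hw : w ∈ l) : w ∉ F.children u := by
      have := hroots w hw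
      simp only [IncForest.roots, Finset.mem_filter, Finset.mem_univ, true_and] at this
      exact this u
    refine Fin.cases ?_ (fun v => ?_) v
    · refine Fin.cases ?_ (fun u => ?_) u <;> simp
    · refine Fin.cases ?_ (fun u => ?_) u <;> refine Fin.cases ?_ (fun u' => ?_) u'
      · intros
        rfl
      · simp only [Fin.cons_zero, Fin.cons_succ, hmem]
        exact fun h h' => absurd h' (hroot _ _ h)
      · simp only [Fin.cons_zero, Fin.cons_succ, hmem]
        exact fun h h' => absurd h (hroot _ _ h')
      · simp only [Fin.cons_succ, hmem]
        exact fun h h' => congrArg Fin.succ (F.parent_unique u u' v h h')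

theorem IncForest.mem_roots {F : IncForest n} {v : Fin n} :
    v ∈ F.roots ↔ ∀ u, v ∉ F.children u := by
  simp [IncForest.roots]

/-- The duplicate-free lists of elements of a finite set. -/
def nodupLists (s : Finset (Fin n)) : Finset {l : List (Fin n) // l.Nodup} :=
  Finset.univ.filter fun l => ∀ v ∈ l.1, v ∈ s

theorem mem_nodupLists {s : Finset (Fin n)} {l : {l : List (Fin n) // l.Nodup}} :
    l ∈ nodupLists s ↔ ∀ v ∈ l.1, v ∈ s := by
  simp [nodupLists]

theorem length_le_of_mem_nodupLists {s : Finset (Fin n)} {l : {l : List (Fin n) // l.Nodup}}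
    (hl : l ∈ nodupLists s) : l.1.length ≤ s.card := by
  rw [← List.toFinset_card_of_nodup l.2]
  exact Finset.card_le_card fun v hv => mem_nodupLists.mp hl v (List.mem_toFinset.mp hv)

/-- Such lists are the embeddings of `Fin i` into `s`. -/
theorem card_nodupLists_length (s : Finset (Fin n)) (i : ℕ) :
    ((nodupLists s).filter fun l => l.1.length = i).card = s.card.descFactorial i := by
  have h : (Finset.univ : Finset (Fin i ↪ s)).card = s.card.descFactorial i := by
    rw [Finset.card_univ, Fintype.card_embedding_eq, Fintype.card_coe, Fintype.card_fin]
  rw [← h]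
  symm
  refine Finset.card_bij (fun f _ => ⟨List.ofFn fun j => (f j : Fin n),
    List.nodup_ofFn.mpr (Subtype.val_injective.comp f.injective)⟩) ?_ ?_ ?_
  · intro f _
    simp [mem_nodupLists, List.mem_ofFn]
  · intro f _ g _ hfg
    ext j : 1
    exact Subtype.ext (congrFun (List.ofFn_injective (Subtype.ext_iff.mp hfg)) j)
  · rintro ⟨l, hl⟩ hmem
    rw [Finset.mem_filter, mem_nodupLists] at hmem
    obtain ⟨hs, rfl⟩ := hmem
    refine ⟨⟨fun j => ⟨l.get j, hs _ (l.get_mem j)⟩, fun a b hab => ?_⟩, Finset.mem_univ _, ?_⟩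
    · exact List.nodup_iff_injective_get.mp hl (Subtype.ext_iff.mp hab)
    · exact Subtype.ext (List.ofFn_get l)

theorem IncForest.numTrees_cons (F : IncForest n) {l : List (Fin n)} (hl : l.Nodup)
    (hroots : ∀ v ∈ l, v ∈ F.roots) :
    (F.cons l hl hroots).numTrees = F.numTrees - l.length + 1 := by
  have h : (F.cons l hl hroots).roots =
      Finset.cons 0 ((F.roots \ l.toFinset).map (Fin.succEmb n)) (by simp) := by
    ext v
    rw [IncForest.mem_roots, Finset.mem_cons, Fin.forall_fin_succ]
    refine Fin.cases ?_ (fun v => ?_) v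
    · simp [IncForest.cons]
    · simp [IncForest.cons, IncForest.mem_roots, and_comm]
  rw [IncForest.numTrees, h, Finset.card_cons, Finset.card_map, Finset.card_sdiff_of_subset,
    List.toFinset_card_of_nodup hl, IncForest.numTrees]
  exact fun v hv => hroots v (List.mem_toFinset.mp hv)

theorem IncForest.weight_cons {R : Type*} [CommRing R] (φ : ℕ → R) (F : IncForest n)
    {l : List (Fin n)} (hl : l.Nodup) (hroots : ∀ v ∈ l, v ∈ F.roots) :
    (F.cons l hl hroots).weight φ = φ l.length * F.weight φ := by
  simp [IncForest.weight, IncForest.cons, Fin.prod_univ_succ]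

/-- Labels increase from parent to child, so vertex 0 is nobody's child and all child lists lie in
the image of `Fin.succ`. Deleting 0 turns its children into roots. -/
theorem IncForest.exists_eq_cons (G : IncForest (n + 1)) :
    ∃ (F : IncForest n) (l : List (Fin n)) (hl : l.Nodup) (hroots : ∀ v ∈ l, v ∈ F.roots),
      G = F.cons l hl hroots := by
  have hex (u : Fin (n + 1)) : ∃ l : List (Fin n), l.map Fin.succ = G.children u := by
    have : G.children u ∈ Set.range (List.map (Fin.succ : Fin n → Fin (n + 1))) := by
      rw [Set.range_list_map]
      intro v hv
      exact ⟨v.pred ((Fin.zero_le u).trans_lt (G.increasing u v hv)).ne', Fin.succ_pred _ _⟩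
    exact this
  choose c hc using hex
  have hmem {u : Fin (n + 1)} {v : Fin n} : v ∈ c u ↔ v.succ ∈ G.children u := by
    simp [← hc]
  have hnodup (u : Fin (n + 1)) : (c u).Nodup := by
    have := G.nodup u
    rw [← hc] at this
    exact this.of_map
  let F : IncForest n :=
    { children := fun u => c u.succ
      nodup := fun u => hnodup _
      increasing := fun u v hv => Fin.succ_lt_succ_iff.mp (G.increasing _ _ (hmem.mp hv))
      parent_unique := fun u u' v hv hv' =>
        Fin.succ_injective n (G.parent_unique _ _ _ (hmem.mp hv) (hmem.mp hv')) }
  refine ⟨F, c 0, hnodup 0, fun v hv => IncForest.mem_roots.mpr fun u hu => ?_, ?_⟩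
  · exact Fin.succ_ne_zero u (G.parent_unique _ _ _ (hmem.mp hu) (hmem.mp hv))
  · ext u : 2
    refine Fin.cases ?_ (fun u => ?_) u
    · exact (hc 0).symm
    · exact (hc u.succ).symm

/-- Forests on `n + 1` vertices correspond to pairs of a forest on `n` vertices and a duplicate-free
list of its roots. -/
theorem IncForest.sum_succ {M : Type*} [AddCommMonoid M] (f : IncForest (n + 1) → M)
    (g : IncForest n → List (Fin n) → M)
    (hfg : ∀ F l hl hroots, f (IncForest.cons F l hl hroots) = g F l) :
    ∑ G, f G = ∑ F, ∑ l ∈ nodupLists F.roots, g F l.1 := by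
  rw [Finset.sum_sigma']
  symm
  refine Finset.sum_bij
    (fun x hx => x.1.cons x.2.1 x.2.2 (mem_nodupLists.mp (Finset.mem_sigma.mp hx).2)) ?_ ?_ ?_ ?_
  · intros
    exact Finset.mem_univ _
  · rintro ⟨F, l, hl⟩ h ⟨F', l', hl'⟩ h' heq
    have hchildren := congrArg IncForest.children heq
    have hinj := (List.map_injective_iff.mpr (Fin.succ_injective n))
    have h0 : l = l' := hinj (congrFun hchildren 0)
    have hF : F = F' := by
      ext u : 2
      exact hinj (congrFun hchildren u.succ)
    subst h0 hF
    rfl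
  · intro G _
    obtain ⟨F, l, hl, hroots, rfl⟩ := G.exists_eq_cons
    exact ⟨⟨F, l, hl⟩, Finset.mem_sigma.mpr ⟨Finset.mem_univ _, mem_nodupLists.mpr hroots⟩, rfl⟩
  · intros
    exact (hfg _ _ _ _).symm

theorem IncForest.numTrees_le (F : IncForest n) : F.numTrees ≤ n := by
  simpa [IncForest.numTrees] using Finset.card_le_univ F.roots

end Forests

/-! ### Recurrence for the generic Lah polynomials -/

section Recurrence

variable {R : Type*} [CommRing R]

/-- The lower-triangular matrix with entries `(n! / k!) φ_{n-k}`. -/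
def factorialToeplitz (φ : ℕ → R) : Matrix ℕ ℕ R :=
  Matrix.of fun n k => (n.descFactorial (n - k) : R) * toeplitz φ n k

theorem factorialToeplitz_of_le (φ : ℕ → R) {n k : ℕ} (h : k ≤ n) :
    factorialToeplitz φ n k = n.descFactorial (n - k) * φ (n - k) := by
  simp [factorialToeplitz, toeplitz, h]

theorem factorialToeplitz_of_lt (φ : ℕ → R) {n k : ℕ} (h : n < k) :
    factorialToeplitz φ n k = 0 := by
  simp [factorialToeplitz, toeplitz, h.not_ge]

/-- Leaving `k` roots unattached forces the length `s.card - k`, and there are (#s)!/k! ordered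
choices. -/
theorem sum_nodupLists {n : ℕ} (φ : ℕ → R) (s : Finset (Fin n)) (k : ℕ) :
    ∑ l ∈ nodupLists s, (if s.card - l.1.length = k then φ l.1.length else 0) =
      factorialToeplitz φ s.card k := by
  rcases lt_or_ge s.card k with h | h
  · rw [factorialToeplitz_of_lt φ h]
    exact Finset.sum_eq_zero fun l _ => if_neg (by omega)
  · have hcongr : ∀ l ∈ nodupLists s,
        (if s.card - l.1.length = k then φ l.1.length else 0) =
          if l.1.length = s.card - k then φ (s.card - k) else 0 := by
      intro l hl
      have := length_le_of_mem_nodupLists hl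
      by_cases h' : l.1.length = s.card - k
      · rw [if_pos (by omega), if_pos h', h']
      · rw [if_neg (by omega), if_neg h']
    rw [Finset.sum_congr rfl hcongr, ← Finset.sum_filter, Finset.sum_const,
      card_nodupLists_length, factorialToeplitz_of_le φ h, nsmul_eq_mul]

theorem genericLah_eq_zero_of_lt (φ : ℕ → R) {n k : ℕ} (h : n < k) : genericLah φ n k = 0 := by
  rw [genericLah, Finset.filter_false_of_mem, Finset.sum_empty]
  intro F _
  have := F.numTrees_le
  omega

theorem genericLah_zero_zero (φ : ℕ → R) : genericLah φ 0 0 = 1 := by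
  have huniq (F G : IncForest 0) : F = G := by
    ext u
    exact u.elim0
  let F : IncForest 0 := ⟨fun u => u.elim0, fun u => u.elim0, fun u => u.elim0, fun u => u.elim0⟩
  rw [genericLah, Finset.filter_true_of_mem fun F _ => Nat.le_zero.mp F.numTrees_le,
    Finset.sum_eq_single F (fun G _ h => absurd (huniq G F) h)
      (fun h => absurd (Finset.mem_univ _) h)]
  simp [IncForest.weight]

theorem genericLah_succ_zero (φ : ℕ → R) (n : ℕ) : genericLah φ (n + 1) 0 = 0 := by
  rw [genericLah, Finset.filter_false_of_mem, Finset.sum_empty]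
  intro G _
  obtain ⟨F, l, hl, hroots, rfl⟩ := G.exists_eq_cons
  rw [IncForest.numTrees_cons]
  omega

/-- Deleting the smallest vertex, itself a root, leaves `j` trees; its children are an ordered
choice of `j - k` of their roots. -/
theorem genericLah_succ_succ (φ : ℕ → R) (n k : ℕ) :
    genericLah φ (n + 1) (k + 1) =
      ∑ j ∈ Finset.range (n + 1), genericLah φ n j * factorialToeplitz φ j k := by
  have hstep : genericLah φ (n + 1) (k + 1) =
      ∑ F : IncForest n, F.weight φ * factorialToeplitz φ F.numTrees k := by
    rw [genericLah, Finset.sum_filter, IncForest.sum_succ _ fun F l =>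
      F.weight φ * if F.numTrees - l.length = k then φ l.length else 0]
    · refine Finset.sum_congr rfl fun F _ => ?_
      rw [← Finset.mul_sum]
      exact congrArg _ (sum_nodupLists φ F.roots k)
    · intro F l hl hroots
      rw [IncForest.numTrees_cons, IncForest.weight_cons]
      simp only [add_left_inj]
      split_ifs <;> ring
  rw [hstep, ← Finset.sum_fiberwise_of_maps_to (t := Finset.range (n + 1))
    (g := fun F : IncForest n => F.numTrees)
    fun F _ => Finset.mem_range.mpr (Nat.lt_succ_of_le F.numTrees_le)]
  refine Finset.sum_congr rfl fun j _ => ?_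
  rw [genericLah, Finset.sum_mul]
  refine Finset.sum_congr rfl fun F hF => ?_
  rw [(Finset.mem_filter.mp hF).2]

end Recurrence

/-! ### Production matrices -/

section Production

variable {R : Type*} [CommRing R]

/-- The finite truncation of an infinite matrix to its first `N + 1` rows and columns. -/
def truncate (N : ℕ) (A : Matrix ℕ ℕ R) : Matrix (Fin (N + 1)) (Fin (N + 1)) R :=
  A.submatrix Fin.val Fin.val

theorem MinorsNonneg.truncate {C : RingCone R} {r : ℕ∞} {A : Matrix ℕ ℕ R}
    (hA : MinorsNonneg C r A) (N : ℕ) : MinorsNonneg C r (truncate N A) :=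
  hA.submatrix Fin.val_strictMono Fin.val_strictMono

/-- If the rows of a lower-triangular matrix `Z` are produced from `c e₀` by the production
matrix `P`, then they are given by the powers of any large enough truncation of `P`. -/
theorem mul_truncate_pow_apply {P Z : Matrix ℕ ℕ R} {c : R}
    (hlow : ∀ n k, n < k → Z n k = 0) (h0 : Z 0 0 = c)
    (hsucc : ∀ n k, Z (n + 1) k = ∑ j ∈ Finset.range (n + 1), Z n j * P j k)
    {N n : ℕ} (hn : n ≤ N) (k : Fin (N + 1)) :
    c * (truncate N P ^ n) 0 k = Z n k := by
  induction n generalizing k with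
  | zero =>
    rcases eq_or_ne k 0 with rfl | hk
    · simp [h0]
    · rw [pow_zero, Matrix.one_apply_ne hk.symm, mul_zero,
        hlow 0 k (Nat.pos_of_ne_zero fun h => hk (Fin.ext h))]
  | succ n ih =>
    have hterm (j : Fin (N + 1)) : c * ((truncate N P ^ n) 0 j * truncate N P j k) =
        Z n j * P j k := by
      rw [← mul_assoc, ih (by omega)]
      rfl
    rw [pow_succ, Matrix.mul_apply, Finset.mul_sum, Finset.sum_congr rfl fun j _ => hterm j,
      hsucc, Fin.sum_univ_eq_sum_range (fun j => Z n j * P j k)]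
    symm
    -- Row `n` of `Z` ends at column `n ≤ N`, so truncation loses nothing.
    refine Finset.sum_subset (Finset.range_mono (by omega)) fun j _ hj => ?_
    rw [hlow n j (by simpa using hj), zero_mul]

/-! ### Binomial matrices and their commutation with the factorial Toeplitz matrix. -/

/-- The binomial triangle with entries `binom(n, k) y^{n-k}`. -/
def binomialTriangle (y : R) : Matrix ℕ ℕ R :=
  Matrix.of fun n k => (n.choose k : R) * y ^ (n - k)

theorem binomialTriangle_of_lt (y : R) {n k : ℕ} (h : n < k) : binomialTriangle y n k = 0 := by
  simp [binomialTriangle, Nat.choose_eq_zero_of_lt h]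

theorem binomialTriangle_succ_zero (y : R) (n : ℕ) :
    binomialTriangle y (n + 1) 0 = y * binomialTriangle y n 0 := by
  simp [binomialTriangle, pow_succ']

theorem binomialTriangle_succ_succ (y : R) (n k : ℕ) :
    binomialTriangle y (n + 1) (k + 1) =
      binomialTriangle y n k + y * binomialTriangle y n (k + 1) := by
  rcases lt_or_ge n (k + 1) with h | h
  · rw [binomialTriangle_of_lt y h]
    simp [binomialTriangle, Nat.choose_succ_succ, Nat.choose_eq_zero_of_lt h]
  · obtain ⟨d, rfl⟩ := Nat.exists_eq_add_of_le h
    have h1 : k + 1 + d + 1 - (k + 1) = d + 1 := by omega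
    have h2 : k + 1 + d - k = d + 1 := by omega
    have h3 : k + 1 + d - (k + 1) = d := by omega
    simp only [binomialTriangle, Matrix.of_apply, h1, h2, h3, Nat.choose_succ_succ, Nat.cast_add]
    ring

/-- Both sides are (k+s+t)!/(k! t!). -/
theorem descFactorial_mul_choose (k s t : ℕ) :
    (k + s + t).descFactorial s * (k + t).choose k =
      (k + s + t).choose (k + s) * (k + s).descFactorial s := by
  have h1 := Nat.factorial_mul_descFactorial (show s ≤ k + s + t by omega)
  have h2 := Nat.add_choose_mul_factorial_mul_factorial k t
  have h3 := Nat.add_choose_mul_factorial_mul_factorial (k + s) t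
  have h4 := Nat.factorial_mul_descFactorial (show s ≤ k + s by omega)
  rw [show k + s + t - s = k + t by omega] at h1
  rw [Nat.add_sub_cancel] at h4
  rw [← Nat.choose_symm_add] at h2 h3
  have hpos : 0 < k.factorial * t.factorial := by positivity
  refine Nat.eq_of_mul_eq_mul_left hpos ?_
  calc k.factorial * t.factorial * ((k + s + t).descFactorial s * (k + t).choose k)
      = (k + t).choose k * k.factorial * t.factorial * (k + s + t).descFactorial s := by ring
    _ = (k + s + t).choose (k + s) * (k + s).factorial * t.factorial := by rw [h2, h1, h3]
    _ = k.factorial * t.factorial *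
        ((k + s + t).choose (k + s) * (k + s).descFactorial s) := by rw [← h4]; ring

theorem sum_range_eq_sum_range_add {f : ℕ → R} {i k d N : ℕ} (hi : i = k + d) (hN : i < N)
    (hlow : ∀ j, j < k → f j = 0) (hhigh : ∀ j, i < j → f j = 0) :
    ∑ j ∈ Finset.range N, f j = ∑ t ∈ Finset.range (d + 1), f (k + t) := by
  obtain ⟨e, rfl⟩ := Nat.exists_eq_add_of_le (show k + (d + 1) ≤ N by omega)
  rw [Finset.sum_range_add, Finset.sum_range_add,
    Finset.sum_eq_zero fun j hj => hlow j (Finset.mem_range.mp hj),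
    Finset.sum_eq_zero (s := Finset.range e) fun j _ => hhigh _ (by omega), zero_add, add_zero]

/-- The matrices `factorialToeplitz φ` and `binomialTriangle y` commute. -/
theorem sum_factorialToeplitz_mul_binomialTriangle (φ : ℕ → R) (y : R) {i N : ℕ} (hi : i < N)
    (k : ℕ) :
    ∑ j ∈ Finset.range N, factorialToeplitz φ i j * binomialTriangle y j k =
      ∑ j ∈ Finset.range N, binomialTriangle y i j * factorialToeplitz φ j k := by
  rcases lt_or_ge i k with h | h
  · rw [Finset.sum_eq_zero, Finset.sum_eq_zero]
    · intro j _
      rcases lt_or_ge i j with hj | hj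
      · rw [binomialTriangle_of_lt y hj, zero_mul]
      · rw [factorialToeplitz_of_lt φ (hj.trans_lt h), mul_zero]
    · intro j _
      rcases lt_or_ge i j with hj | hj
      · rw [factorialToeplitz_of_lt φ hj, zero_mul]
      · rw [binomialTriangle_of_lt y (hj.trans_lt h), mul_zero]
  -- Both sums are convolutions over s + t = d, with middle index k + t on the left and k + s on the
  -- right; reflecting one matches them term by term.
  · obtain ⟨d, rfl⟩ := Nat.exists_eq_add_of_le h
    rw [sum_range_eq_sum_range_add rfl hi
        (fun j hj => by rw [binomialTriangle_of_lt y hj, mul_zero])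
        (fun j hj => by rw [factorialToeplitz_of_lt φ hj, zero_mul]),
      sum_range_eq_sum_range_add rfl hi
        (fun j hj => by rw [factorialToeplitz_of_lt φ hj, mul_zero])
        (fun j hj => by rw [binomialTriangle_of_lt y hj, zero_mul]),
      ← Finset.sum_range_reflect]
    refine Finset.sum_congr rfl fun s hs => ?_
    obtain ⟨t, rfl⟩ := Nat.exists_eq_add_of_le (Nat.lt_succ_iff.mp (Finset.mem_range.mp hs))
    have hnat := congrArg (Nat.cast : ℕ → R) (descFactorial_mul_choose k s t)
    push_cast at hnat
    rw [show s + t + 1 - 1 - s = t by omega, factorialToeplitz_of_le φ (by omega),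
      factorialToeplitz_of_le φ (by omega)]
    simp only [binomialTriangle, Matrix.of_apply]
    rw [show k + (s + t) - (k + t) = s by omega, show k + t - k = t by omega,
      show k + (s + t) - (k + s) = t by omega, show k + s - k = s by omega, ← add_assoc k s t]
    linear_combination φ s * y ^ t * hnat

/-! ### The production matrix F(yI + Δ) and its consequences. -/

/-- The production matrix of the binomial row-generating matrix of the generic Lah triangle. -/
def lahProduction (φ : ℕ → R) (y : R) : Matrix ℕ ℕ R :=
  Matrix.of fun n k => y * factorialToeplitz φ n k +
    if k = 0 then 0 else factorialToeplitz φ n (k - 1)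

theorem truncate_lahProduction (φ : ℕ → R) (y : R) (N : ℕ) :
    truncate N (lahProduction φ y) =
      truncate N (factorialToeplitz φ) * truncate N (bidiagonal y) := by
  -- Column `k` of the bidiagonal matrix is supported in rows `≤ k`, so the truncated product is
  -- exact.
  ext i ⟨k, hk⟩
  simp only [truncate, Matrix.mul_apply, Matrix.submatrix_apply]
  rw [Fin.sum_univ_eq_sum_range (fun j => factorialToeplitz φ i j * bidiagonal y j k)]
  simp only [bidiagonal, lahProduction, Matrix.of_apply, mul_add, Finset.sum_add_distrib]
  congr 1
  · simp [hk, mul_comm]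
  · cases k with
    | zero => simp
    | succ k => simp [show k < N + 1 by omega]

theorem lahProduction_truncate_minorsNonneg {C : RingCone R} {r : ℕ∞} {φ : ℕ → R} {y : R}
    (hφ : MinorsNonneg C r (toeplitz φ)) (hy : y ∈ C) (N : ℕ) :
    MinorsNonneg C r (truncate N (lahProduction φ y)) := by
  rw [truncate_lahProduction]
  refine MinorsNonneg.mul (MinorsNonneg.truncate ?_ N)
    ((bidiagonal_minorsNonneg hy).truncate N)
  exact hφ.descFactorial_mul fun i j h => by simp [toeplitz, h.not_ge]

/-- The binomial row-generating matrix of the generic Lah triangle. -/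
def lahBinomial (φ : ℕ → R) (y : R) : Matrix ℕ ℕ R :=
  Matrix.of fun n k => ∑ j ∈ Finset.range (n + 1), genericLah φ n j * binomialTriangle y j k

theorem lahBinomial_of_lt (φ : ℕ → R) (y : R) {n k : ℕ} (h : n < k) :
    lahBinomial φ y n k = 0 := by
  rw [lahBinomial, Matrix.of_apply]
  refine Finset.sum_eq_zero fun j hj => ?_
  rw [binomialTriangle_of_lt y (by have := Finset.mem_range.mp hj; omega), mul_zero]

theorem lahBinomial_zero_zero (φ : ℕ → R) (y : R) : lahBinomial φ y 0 0 = 1 := by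
  simp [lahBinomial, genericLah_zero_zero, binomialTriangle]

/-- FΔB_y = FB_y(yI + Δ) = B_yF(yI + Δ), by Pascal's rule and commutation. -/
theorem sum_factorialToeplitz_mul_binomialTriangle_succ (φ : ℕ → R) (y : R) {i N : ℕ}
    (hi : i < N) (k : ℕ) :
    ∑ j ∈ Finset.range N, factorialToeplitz φ i j * binomialTriangle y (j + 1) k =
      ∑ j ∈ Finset.range N, binomialTriangle y i j * lahProduction φ y j k := by
  cases k with
  | zero =>
    simp only [binomialTriangle_succ_zero, lahProduction, Matrix.of_apply, if_true, add_zero,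
      mul_left_comm _ y, ← Finset.mul_sum, sum_factorialToeplitz_mul_binomialTriangle φ y hi]
  | succ k =>
    simp only [binomialTriangle_succ_succ, lahProduction, Matrix.of_apply, Nat.succ_ne_zero,
      if_false, mul_add, Finset.sum_add_distrib, mul_left_comm _ y, ← Finset.mul_sum,
      sum_factorialToeplitz_mul_binomialTriangle φ y hi, Nat.add_sub_cancel]
    ring

theorem lahBinomial_succ (φ : ℕ → R) (y : R) (n k : ℕ) :
    lahBinomial φ y (n + 1) k =
      ∑ j ∈ Finset.range (n + 1), lahBinomial φ y n j * lahProduction φ y j k := by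
  simp only [lahBinomial, Matrix.of_apply]
  rw [Finset.sum_range_succ', genericLah_succ_zero, zero_mul, add_zero]
  simp only [genericLah_succ_succ, Finset.sum_mul, mul_assoc]
  rw [Finset.sum_comm, Finset.sum_comm (s := Finset.range (n + 1)) (t := Finset.range (n + 1))
    (f := fun j i => genericLah φ n i * (binomialTriangle y i j * lahProduction φ y j k))]
  refine Finset.sum_congr rfl fun i hi => ?_
  rw [← Finset.mul_sum, ← Finset.mul_sum,
    sum_factorialToeplitz_mul_binomialTriangle_succ φ y (Finset.mem_range.mp hi)]

theorem truncate_lahProduction_pow_apply (φ : ℕ → R) (y : R) {N n : ℕ} (hn : n ≤ N)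
    (k : Fin (N + 1)) : (truncate N (lahProduction φ y) ^ n) 0 k = lahBinomial φ y n k := by
  rw [← mul_truncate_pow_apply (fun _ _ h => lahBinomial_of_lt φ y h)
    (lahBinomial_zero_zero φ y) (lahBinomial_succ φ y) hn, one_mul]

theorem lahBinomial_minorsNonneg {C : RingCone R} {r : ℕ∞} {φ : ℕ → R} {y : R}
    (hφ : MinorsNonneg C r (toeplitz φ)) (hy : y ∈ C) : MinorsNonneg C r (lahBinomial φ y) := by
  refine minorsNonneg_of_truncations fun N => ?_
  convert (lahProduction_truncate_minorsNonneg hφ hy N).zeroth_rows_pow.submatrix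
    (Fin.val_strictMono (n := N + 1)) strictMono_id using 1
  ext i k
  exact (truncate_lahProduction_pow_apply φ y (by omega) k).symm

/-- A sequence which is a nonnegative multiple of the moments of totally positive matrices is
Hankel-totally positive. -/
theorem hankel_minorsNonneg_of_pow {C : RingCone R} {r : ℕ∞} {a : ℕ → R} {c : R} (hc : c ∈ C)
    {P : Matrix ℕ ℕ R} (hP : ∀ N, MinorsNonneg C r (truncate N P))
    (ha : ∀ N n, n ≤ N → c * (truncate N P ^ n) 0 0 = a n) : MinorsNonneg C r (hankel a) := by
  refine minorsNonneg_of_truncations fun N => ?_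
  -- Indices up to `N` produce moments of order up to `N + N`.
  convert ((hP (N + N)).hankel_pow.smul hc).submatrix (Fin.val_strictMono (n := N + 1))
    (Fin.val_strictMono (n := N + 1)) using 1
  ext i j
  exact (ha (N + N) (i + j) (by omega)).symm

theorem lahBinomial_hankel_minorsNonneg {C : RingCone R} {r : ℕ∞} {φ : ℕ → R} {y : R}
    (hφ : MinorsNonneg C r (toeplitz φ)) (hy : y ∈ C) :
    MinorsNonneg C r (hankel fun n => lahBinomial φ y n 0) := by
  refine hankel_minorsNonneg_of_pow (one_mem C)
    (lahProduction_truncate_minorsNonneg hφ hy) fun N n hn => ?_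
  rw [one_mul]
  exact truncate_lahProduction_pow_apply φ y hn 0

/-- At y = 0 the binomial triangle is the identity, since 0⁰ = 1. -/
theorem lahBinomial_zero (φ : ℕ → R) : lahBinomial φ 0 = lahTriangle φ := by
  ext n k
  have hterm (j : ℕ) : genericLah φ n j * binomialTriangle 0 j k =
      if j = k then genericLah φ n j else 0 := by
    rcases lt_trichotomy j k with h | rfl | h
    · rw [binomialTriangle_of_lt _ h, mul_zero, if_neg h.ne]
    · simp [binomialTriangle]
    · simp [binomialTriangle, h.ne', Nat.sub_ne_zero_of_lt h]
  simp only [lahBinomial, lahTriangle, Matrix.of_apply, hterm]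
  rw [Finset.sum_ite_eq' (Finset.range (n + 1)) k, ite_eq_left_iff, Finset.mem_range]
  exact fun h => (genericLah_eq_zero_of_lt φ (by omega)).symm

theorem genericLah_map {S : Type*} [CommRing S] (f : R →+* S) (φ : ℕ → R) (n k : ℕ) :
    genericLah (fun i => f (φ i)) n k = f (genericLah φ n k) := by
  simp [genericLah, IncForest.weight, map_sum, map_prod]

theorem lahBinomial_X_zero (φ : ℕ → R) (n : ℕ) :
    lahBinomial (fun i => C (φ i)) X n 0 = lahPoly φ n := by
  simp [lahBinomial, lahPoly, binomialTriangle, genericLah_map]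

theorem C_mem_coeffCone {K : RingCone R} {x : R} (hx : x ∈ K) : C x ∈ coeffCone K := by
  intro i
  rw [coeff_C]
  split_ifs
  exacts [hx, zero_mem K]

theorem X_mem_coeffCone (K : RingCone R) : X ∈ coeffCone K := by
  intro i
  rw [coeff_X]
  split_ifs
  exacts [one_mem K, zero_mem K]

theorem toeplitz_map {S : Type*} [CommRing S] (f : R →+* S) (φ : ℕ → R) :
    (toeplitz φ).map f = toeplitz fun i => f (φ i) := by
  ext i j
  simp only [toeplitz, Matrix.map_apply, Matrix.of_apply]
  split_ifs <;> simp

/-- For Z = (L_{n+1,k+1}) the recurrence reads Z_{n+1,k} = ∑ⱼ Z_{n,j} F_{j+1,k}, because L_{n+1,0} =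
0; the scalar is Z₀₀ = φ₀. -/
theorem mul_truncate_pow_eq_genericLah_succ_one (φ : ℕ → R) {N n : ℕ} (hn : n ≤ N) :
    φ 0 * (truncate N ((factorialToeplitz φ).submatrix Nat.succ id) ^ n) 0 0 =
      genericLah φ (n + 1) 1 := by
  refine mul_truncate_pow_apply
    (Z := Matrix.of fun n k => genericLah φ (n + 1) (k + 1)) ?_ ?_ ?_ hn 0
  · exact fun n k h => genericLah_eq_zero_of_lt φ (by omega)
  · simp [genericLah_succ_succ, genericLah_zero_zero, factorialToeplitz_of_le]
  · intro n k
    rw [Matrix.of_apply, genericLah_succ_succ, Finset.sum_range_succ', genericLah_succ_zero,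
      zero_mul, add_zero]
    rfl

theorem genericLah_succ_one_hankel_minorsNonneg {C : RingCone R} {r : ℕ∞} {φ : ℕ → R}
    (hφ : MinorsNonneg C r (toeplitz φ)) (h0 : φ 0 ∈ C) :
    MinorsNonneg C r (hankel fun n => genericLah φ (n + 1) 1) := by
  refine hankel_minorsNonneg_of_pow h0 (fun N => MinorsNonneg.truncate ?_ N)
    fun N n hn => mul_truncate_pow_eq_genericLah_succ_one φ hn
  refine MinorsNonneg.submatrix ?_ (fun _ _ h => Nat.succ_lt_succ h) strictMono_id
  exact hφ.descFactorial_mul fun i j h => by simp [toeplitz, h.not_ge]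

end Production

end LahTP

theorem theorem1p1 {R : Type*} [CommRing R] (C : RingCone R) (r : ℕ∞) (hr : 1 ≤ r)
    (φ : ℕ → R) (hφ : LahTP.IsToeplitzTP C r φ) :
    LahTP.IsTP C r (LahTP.lahTriangle φ) ∧
    LahTP.IsHankelTP (LahTP.coeffCone C) r (LahTP.lahPoly φ) ∧
    LahTP.IsHankelTP C r (fun n => LahTP.genericLah φ (n + 1) 1) := by
  have htp : LahTP.MinorsNonneg C r (LahTP.toeplitz φ) := hφ
  have h0 : φ 0 ∈ C := by
    -- φ₀ is a 1 × 1 minor, available because `1 ≤ r`.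
    have h := htp 1 (by simpa using hr) Fin.val Fin.val Fin.val_strictMono Fin.val_strictMono
    simpa [LahTP.toeplitz] using h
  refine ⟨?_, ?_, LahTP.genericLah_succ_one_hankel_minorsNonneg htp h0⟩
  · have h := LahTP.lahBinomial_minorsNonneg htp (zero_mem C)
    rwa [LahTP.lahBinomial_zero] at h
  -- Here the base ring becomes R[X] and y the indeterminate, nonnegative in the coefficientwise
  -- order.
  · have hpoly := htp.map Polynomial.C fun x hx => LahTP.C_mem_coeffCone hx
    rw [LahTP.toeplitz_map] at hpoly
    have h := LahTP.lahBinomial_hankel_minorsNonneg hpoly (LahTP.X_mem_coeffCone C)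
    simp only [LahTP.lahBinomial_X_zero] at h
    exact h
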